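/- Let $k$ be a field and let $\mathcal{C}$ be a skeletally small, $k$-linear, $\operatorname{Hom}$-finite, idempotent complete, triangulated category with suspension $\Sigma$. Let $\mathcal{X}\subseteq\mathcal{T}$ be full subcategories of $\mathcal{C}$ which are additive (closed under isomorphisms, finite direct sums and direct summands) and contravariantly finite, and such that $\mathcal{T}$ is rigid, i.e. $\mathcal{C}(\mathcal{T},\Sigma\mathcal{T})=0$. For an additive subcategory $\mathcal{D}$, let $\operatorname{indec}\mathcal{D}$ be the class of indecomposable objects of $\mathcal{D}$ lying in a fixed skeleton of $\mathcal{C}$, and let $\mathcal{Y}$ be the additive subcategory of $\mathcal{C}$ with $\operatorname{indec}\mathcal{T}=\operatorname{indec}\mathcal{X}\mathbin{\dot\cup}\operatorname{indec}\mathcal{Y}$. For $\mathcal{D}\in\{\mathcal{X},\mathcal{T}\}$, let $\operatorname{mod}\mathcal{D}$ be the abelian category of finitely presented additive functors $\mathcal{D}^{\mathrm{op}}\to\mathsf{Ab}$ and let $H_{\mathcal{D}}\colon\mathcal{C}\to\operatorname{mod}\mathcal{D}$, $H_{\mathcal{D}}(C)=\mathcal{C}(-,C)|_{\mathcal{D}}$.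 Let $K_0(\mathcal{C},\mathbb{E}_{\mathcal{D}},\mathfrak{s}_{\mathcal{D}})$ be the quotient of the split Grothendieck group $K_0^{\mathrm{sp}}(\mathcal{C})$ by the subgroup generated by all $[A]-[B]+[C]$ for which there is a triangle $A\to B\to C\xrightarrow{\delta}\Sigma A$ in $\mathcal{C}$ with $H_{\mathcal{D}}(\delta)=0$, and write $[C]_{\mathcal{D}}$ for the class of $C$ in it. Let $Q\colon K_0(\mathcal{C},\mathbb{E}_{\mathcal{T}},\mathfrak{s}_{\mathcal{T}})\to K_0(\mathcal{C},\mathbb{E}_{\mathcal{X}},\mathfrak{s}_{\mathcal{X}})$ be the canonical surjection $[C]_{\mathcal{T}}\mapsto[C]_{\mathcal{X}}$. Suppose that $\mathcal{T}$ is locally bounded (it is $\operatorname{Hom}$-finite and, for each indecomposable $A\in\mathcal{T}$, there are only finitely many $B\in\operatorname{indec}\mathcal{T}$ with $\mathcal{T}(A,B)\neq0$ or $\mathcal{T}(B,A)\neq0$) and has right almost split morphisms (each indecomposable $A\in\mathcal{T}$ admits a morphism $E\to A$ in $\mathcal{T}$ that is not a split epimorphism and through which every morphism $Z\to A$ in $\mathcal{T}$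 that is not a split epimorphism factors). Then there is a unique group homomorphism $\theta_{\mathcal{T}}\colon K_0(\operatorname{mod}\mathcal{T})\to K_0(\mathcal{C},\mathbb{E}_{\mathcal{T}},\mathfrak{s}_{\mathcal{T}})$ with $\theta_{\mathcal{T}}([H_{\mathcal{T}}(C)])=[C]_{\mathcal{T}}+[\Sigma^{-1}C]_{\mathcal{T}}$ for all $C\in\mathcal{C}$, and $$\operatorname{Ker} Q=\big\langle\,\theta_{\mathcal{T}}([S_Y])\;\big|\;Y\in\operatorname{indec}\mathcal{Y}\,\big\rangle,$$ where $S_Y\in\operatorname{mod}\mathcal{T}$ is the simple top of $\mathcal{T}(-,Y)$, i.e. the quotient of $\mathcal{T}(-,Y)$ by its radical (the intersection of its maximal subfunctors). -/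

import Mathlib

open CategoryTheory CategoryTheory.Limits CategoryTheory.Pretriangulated Opposite

namespace RelIndex

universe v u

section Generic

variable {A : Type u} [Category.{v} A]

/-- `f : E ⟶ Y` is right almost split: it is not a split epimorphism, and every morphism to `Y`
that is not a split epimorphism factors through `f`. -/
def IsRightAlmostSplit {E Y : A} (f : E ⟶ Y) : Prop :=
  ¬ IsSplitEpi f ∧ ∀ ⦃Z : A⦄ (g : Z ⟶ Y), ¬ IsSplitEpi g → ∃ h : Z ⟶ E, h ≫ f = g

/-- The Grothendieck group of an abelian category (the definition makes sense for any category
with zero morphisms): the free abelian group on the objects modulo the relations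
`[S.X₂] = [S.X₁] + [S.X₃]` for all short exact sequences `S`. -/
abbrev K0 (A : Type u) [Category.{v} A] [HasZeroMorphisms A] : Type u :=
  FreeAbelianGroup A ⧸ AddSubgroup.closure
    {x : FreeAbelianGroup A | ∃ S : ShortComplex A, S.ShortExact ∧
      x = FreeAbelianGroup.of S.X₂ - FreeAbelianGroup.of S.X₁ - FreeAbelianGroup.of S.X₃}

/-- The class of an object in the Grothendieck group. -/
def K0.mk [HasZeroMorphisms A] (M : A) : K0 A :=
  QuotientAddGroup.mk (FreeAbelianGroup.of M)

/-- The split Grothendieck group of an additive category. -/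
abbrev K0Split (A : Type u) [Category.{v} A] [Preadditive A] [HasBinaryBiproducts A] : Type u :=
  FreeAbelianGroup A ⧸ AddSubgroup.closure
    {x : FreeAbelianGroup A | ∃ L M N : A, Nonempty (M ≅ L ⊞ N) ∧
      x = FreeAbelianGroup.of M - FreeAbelianGroup.of L - FreeAbelianGroup.of N}

/-- The class of an object in the split Grothendieck group. -/
def K0Split.mk [Preadditive A] [HasBinaryBiproducts A] (M : A) : K0Split A :=
  QuotientAddGroup.mk (FreeAbelianGroup.of M)

/-- A subfunctor of a contravariant functor to abelian groups. -/
@[ext]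
structure AbSubfunctor (M : Aᵒᵖ ⥤ AddCommGrpCat.{v}) where
  /-- the subgroup at each object -/
  obj : ∀ X : Aᵒᵖ, AddSubgroup (M.obj X)
  map_mem : ∀ {X Y : Aᵒᵖ} (f : X ⟶ Y) (x : M.obj X), x ∈ obj X → M.map f x ∈ obj Y

namespace AbSubfunctor

variable {M : Aᵒᵖ ⥤ AddCommGrpCat.{v}}

instance : PartialOrder (AbSubfunctor M) :=
  PartialOrder.lift AbSubfunctor.obj (fun _ _ h => AbSubfunctor.ext h)

instance : OrderTop (AbSubfunctor M) where
  top := ⟨fun _ => ⊤, fun _ _ _ => AddSubgroup.mem_top _⟩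
  le_top _ := fun _ => le_top

/-- The quotient functor `M / N`. -/
def quotient (N : AbSubfunctor M) : Aᵒᵖ ⥤ AddCommGrpCat.{v} where
  obj X := AddCommGrpCat.of (M.obj X ⧸ N.obj X)
  map {X Y} f := AddCommGrpCat.ofHom
    (QuotientAddGroup.map (N.obj X) (N.obj Y) (M.map f).hom (fun x hx => N.map_mem f x hx))
  map_id X := by
    refine AddCommGrpCat.hom_ext (QuotientAddGroup.addMonoidHom_ext _ ?_)
    ext x
    simp
  map_comp f g := by
    refine AddCommGrpCat.hom_ext (QuotientAddGroup.addMonoidHom_ext _ ?_)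
    ext x
    simp
    rfl

/-- The projection `M ⟶ M / N`. -/
def proj (N : AbSubfunctor M) : M ⟶ N.quotient where
  app X := AddCommGrpCat.ofHom (QuotientAddGroup.mk' (N.obj X))
  naturality _ _ _ := by
    ext x
    rfl

end AbSubfunctor

/-- The radical of a functor: the intersection of its maximal (proper) subfunctors. -/
def radical (M : Aᵒᵖ ⥤ AddCommGrpCat.{v}) : AbSubfunctor M where
  obj X := ⨅ N : {N : AbSubfunctor M // IsCoatom N}, N.1.obj X
  map_mem f x hx := by
    rw [AddSubgroup.mem_iInf] at hx ⊢
    exact fun N => N.1.map_mem f x (hx N)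

/-- The top `M / rad M` of a functor. -/
def functorTop (M : Aᵒᵖ ⥤ AddCommGrpCat.{v}) : Aᵒᵖ ⥤ AddCommGrpCat.{v} :=
  (radical M).quotient

/-- A functor `M : Aᵒᵖ ⥤ Ab` is finitely presented if there is an exact sequence
`A(-, P) ⟶ A(-, R) ⟶ M ⟶ 0`. Such a functor is automatically additive. -/
def finitelyPresented (A : Type u) [Category.{v} A] [Preadditive A] :
    ObjectProperty (Aᵒᵖ ⥤ AddCommGrpCat.{v}) := fun M =>
  ∃ (P R : A) (f : preadditiveYoneda.obj P ⟶ preadditiveYoneda.obj R)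
    (p : preadditiveYoneda.obj R ⟶ M), ∀ X : Aᵒᵖ,
      Function.Exact (f.app X) (p.app X) ∧ Function.Surjective (p.app X)

/-- `mod A`: the category of finitely presented (additive) functors `Aᵒᵖ ⥤ Ab`. -/
abbrev FPMod (A : Type u) [Category.{v} A] [Preadditive A] : Type (max u (v + 1)) :=
  (finitelyPresented A).FullSubcategory

/-- The top of `A(-, Y)` is finitely presented if `Y` admits a right almost split morphism. -/
theorem finitelyPresented_top [Preadditive A] {E Y : A} (f : E ⟶ Y) (hf : IsRightAlmostSplit f) :
    finitelyPresented A (functorTop (preadditiveYoneda.obj Y)) := by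
  let im : AbSubfunctor (preadditiveYoneda.obj Y) :=
    { obj := fun X => ((preadditiveYoneda.map f).app X).hom.range
      map_mem := by
        rintro X Z g _ ⟨y, rfl⟩
        exact ⟨g.unop ≫ y, Category.assoc _ _ _⟩ }
  have key : ∀ N : AbSubfunctor (preadditiveYoneda.obj Y), N ≠ ⊤ → N ≤ im := by
    intro N hN X x hx
    by_cases hs : IsSplitEpi (show X.unop ⟶ Y from x)
    · exfalso
      apply hN
      apply le_antisymm le_top
      intro Z z _
      obtain ⟨s, hs⟩ := hs.exists_splitEpi.some
      have := N.map_mem (Quiver.Hom.op ((show Z.unop ⟶ Y from z) ≫ s)) x hx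
      have e : (preadditiveYoneda.obj Y).map (Quiver.Hom.op ((show Z.unop ⟶ Y from z) ≫ s)) x
          = z := by
        change ((show Z.unop ⟶ Y from z) ≫ s) ≫ (show X.unop ⟶ Y from x) = z
        rw [Category.assoc, hs, Category.comp_id]
      rwa [e] at this
    · obtain ⟨h, hh⟩ := hf.2 _ hs
      exact ⟨h, hh⟩
  have him : im ≠ ⊤ := by
    intro h
    have h1 : (show (preadditiveYoneda.obj Y).obj (op Y) from 𝟙 Y) ∈ im.obj (op Y) := by
      rw [h]
      exact AddSubgroup.mem_top _
    obtain ⟨s, hs⟩ := h1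
    exact hf.1 ⟨⟨⟨s, hs⟩⟩⟩
  have hmax : IsCoatom im :=
    ⟨him, fun N hN => by
      by_contra h
      exact absurd (key N h) (not_le_of_gt hN)⟩
  have hrad : ∀ X, (radical (preadditiveYoneda.obj Y)).obj X = im.obj X := by
    intro X
    apply le_antisymm
    · exact iInf_le (fun N : {N : AbSubfunctor (preadditiveYoneda.obj Y) // IsCoatom N} =>
        N.1.obj X) ⟨im, hmax⟩
    · refine le_iInf fun N => ?_
      have : N.1 = im := by
        by_contra hne
        exact him (N.2.2 im (lt_of_le_of_ne (key N.1 N.2.1) hne))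
      rw [this]
  refine ⟨E, Y, preadditiveYoneda.map f, (radical _).proj, fun X => ⟨?_, ?_⟩⟩
  · intro y
    refine (QuotientAddGroup.eq_zero_iff (N := (radical (preadditiveYoneda.obj Y)).obj X) y).trans
      ?_
    rw [hrad]
    rfl
  · exact QuotientAddGroup.mk'_surjective _

end Generic

section Subcategories

variable {C : Type u} [Category.{v} C] [Preadditive C]

/-- An additive subcategory: a full subcategory closed under isomorphisms, (finite) direct sums
and direct summands. -/
structure IsAdditiveSubcategory [HasBinaryBiproducts C] (P : ObjectProperty C) : Prop where
  zero_mem : ∃ Z : C, IsZero Z ∧ P Z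
  of_iso : ∀ {M N : C}, (M ≅ N) → P M → P N
  biprod_mem : ∀ {M N : C}, P M → P N → P (M ⊞ N)
  summand_mem : ∀ {M N : C}, P (M ⊞ N) → P M

/-- Every object of `C` has a right `P`-approximation. -/
def IsContravariantlyFinite (P : ObjectProperty C) : Prop :=
  ∀ M : C, ∃ (N : C) (ξ : N ⟶ M), P N ∧
    ∀ ⦃N' : C⦄, P N' → ∀ g : N' ⟶ M, ∃ h : N' ⟶ N, h ≫ ξ = g

/-- `indec P`: the indecomposable objects, lying in `P`, of a fixed skeleton of `C`. -/
def indec [HasBinaryBiproducts C] (P : ObjectProperty C) : Set (Skeleton C) :=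
  {s | P ((fromSkeleton C).obj s) ∧ Indecomposable ((fromSkeleton C).obj s)}

/-- The full subcategory `P` of a `k`-linear category is locally bounded. -/
structure IsLocallyBounded (k : Type*) [Field k] [Linear k C] [HasBinaryBiproducts C]
    (P : ObjectProperty C) : Prop where
  homFinite : ∀ {M N : C}, P M → P N → Module.Finite k (M ⟶ N)
  finite : ∀ M : C, P M → Indecomposable M →
    {s : Skeleton C | s ∈ indec P ∧ ((∃ f : M ⟶ (fromSkeleton C).obj s, f ≠ 0) ∨
      ∃ f : (fromSkeleton C).obj s ⟶ M, f ≠ 0)}.Finite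

/-- The full subcategory `P` has right almost split morphisms: each indecomposable object `Y`
of `P` admits a morphism `E ⟶ Y` which is right almost split in `P`. -/
def HasRightAlmostSplitMorphisms [HasBinaryBiproducts C] (P : ObjectProperty C) : Prop :=
  ∀ Y : P.FullSubcategory, Indecomposable Y.obj →
    ∃ (E : P.FullSubcategory) (f : E ⟶ Y), IsRightAlmostSplit f

/-- The simple top `S_Y` of `P(-, Y)`, as an object of `mod P`, for `Y` indecomposable in `P`. -/
def simpleTop [HasBinaryBiproducts C] {P : ObjectProperty C}
    (hP : HasRightAlmostSplitMorphisms P) (Y : P.FullSubcategory) (hY : Indecomposable Y.obj) :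
    FPMod P.FullSubcategory where
  obj := functorTop (preadditiveYoneda.obj Y)
  property := by
    obtain ⟨E, f, hf⟩ := hP Y hY
    exact finitelyPresented_top f hf

/-- The functor `C ⟶ Mod D`, `M ↦ C(-, M)|_D`. -/
def restrictedYoneda (D : ObjectProperty C) : C ⥤ (D.FullSubcategoryᵒᵖ ⥤ AddCommGrpCat.{v}) :=
  preadditiveYoneda ⋙ (Functor.whiskeringLeft _ _ _).obj D.ι.op

end Subcategories

section Triangulated

variable {C : Type u} [Category.{v} C] [Preadditive C] [HasZeroObject C] [HasShift C ℤ]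
  [∀ n : ℤ, (shiftFunctor C n).Additive] [Pretriangulated C]

/-- `P` is rigid: `C(P, ΣP) = 0`. -/
def IsRigid (P : ObjectProperty C) : Prop :=
  ∀ ⦃M N : C⦄, P M → P N → ∀ f : M ⟶ N⟦(1 : ℤ)⟧, f = 0

/-- If `D` is contravariantly finite in the triangulated category `C`, then every functor
`C(-, M)|_D` is finitely presented. -/
theorem finitelyPresented_restrictedYoneda {D : ObjectProperty C}
    (hD : IsContravariantlyFinite D) (M : C) :
    finitelyPresented D.FullSubcategory ((restrictedYoneda D).obj M) := by
  obtain ⟨R, ξ, hR, hξ⟩ := hD M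
  obtain ⟨K, i, δ, hK⟩ := distinguished_cocone_triangle₁ ξ
  obtain ⟨P, η, hP, hη⟩ := hD K
  let P' : D.FullSubcategory := ⟨P, hP⟩
  let R' : D.FullSubcategory := ⟨R, hR⟩
  refine ⟨P', R', preadditiveYoneda.map (D.homMk (η ≫ i)),
    { app := fun X => AddCommGrpCat.ofHom
        { toFun := fun g : X.unop ⟶ R' => (show X.unop.obj ⟶ M from g.hom ≫ ξ)
          map_zero' := zero_comp
          map_add' := fun _ _ => Preadditive.add_comp _ _ _ _ _ _ }
      naturality := fun X Z f => by
        ext g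
        exact Category.assoc _ _ _ }, fun X => ⟨?_, ?_⟩⟩
  · intro g
    change X.unop ⟶ R' at g
    constructor
    · intro h
      change g.hom ≫ ξ = 0 at h
      obtain ⟨a, ha⟩ := Triangle.coyoneda_exact₂ _ hK g.hom h
      change X.unop.obj ⟶ K at a
      obtain ⟨b, hb⟩ := hη X.unop.property a
      refine ⟨(D.homMk b : X.unop ⟶ P'), ?_⟩
      apply ObjectProperty.hom_ext
      change b ≫ (η ≫ i) = g.hom
      rw [← Category.assoc, hb]
      exact ha.symm
    · rintro ⟨b, rfl⟩
      change X.unop ⟶ P' at b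
      change (b.hom ≫ (η ≫ i)) ≫ ξ = 0
      have : i ≫ ξ = 0 := comp_distTriang_mor_zero₁₂ _ hK
      simp [this]
  · intro g
    obtain ⟨h, hh⟩ := hξ X.unop.property (show X.unop.obj ⟶ M from g)
    exact ⟨(D.homMk h : X.unop ⟶ R'), hh⟩

/-- The functor `H_D : C ⥤ mod D`, `M ↦ C(-, M)|_D`. -/
def Hfun {D : ObjectProperty C} (hD : IsContravariantlyFinite D) : C ⥤ FPMod D.FullSubcategory :=
  (finitelyPresented D.FullSubcategory).lift (restrictedYoneda D)
    (finitelyPresented_restrictedYoneda hD)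

/-- The relative extensions `E_D(N, L) = {δ : N ⟶ ΣL | C(-, δ)|_D = 0}`. -/
def relExt (D : ObjectProperty C) (N L : C) : Set (N ⟶ L⟦(1 : ℤ)⟧) :=
  {δ | (restrictedYoneda D).map δ = 0}

/-- The subgroup `I_D` of the split Grothendieck group, generated by `[L] - [M] + [N]` for all
extriangles `L ⟶ M ⟶ N ⇢` of `(C, E_D, s_D)`, that is, for all distinguished triangles
`L ⟶ M ⟶ N ⟶ ΣL` whose last morphism lies in `E_D(N, L)`. -/
def relationSubgroup (D : ObjectProperty C) : AddSubgroup (K0Split C) :=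
  AddSubgroup.closure
    {x | ∃ (L M N : C) (f : L ⟶ M) (g : M ⟶ N) (δ : N ⟶ L⟦(1 : ℤ)⟧),
      Triangle.mk f g δ ∈ distTriang C ∧ δ ∈ relExt D N L ∧
      x = K0Split.mk L - K0Split.mk M + K0Split.mk N}

/-- The Grothendieck group `K₀(C, E_D, s_D)` of the relative extriangulated category. -/
abbrev relK0 (D : ObjectProperty C) : Type u := K0Split C ⧸ relationSubgroup D

/-- The index with respect to `D`: the class `[M]_D` of `M` in `K₀(C, E_D, s_D)`. -/
def index (D : ObjectProperty C) (M : C) : relK0 D := QuotientAddGroup.mk (K0Split.mk M)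

theorem relationSubgroup_antitone {X T : ObjectProperty C} (h : X ≤ T) :
    relationSubgroup T ≤ relationSubgroup X := by
  apply AddSubgroup.closure_mono
  rintro x ⟨L, M, N, f, g, δ, hd, hδ, rfl⟩
  refine ⟨L, M, N, f, g, δ, hd, ?_, rfl⟩
  ext D y
  exact congrArg (fun α => α y) (NatTrans.congr_app hδ (op ⟨D.unop.obj, h _ D.unop.property⟩))

/-- The canonical surjection `Q : K₀(C, E_T, s_T) → K₀(C, E_X, s_X)`, `[M]_T ↦ [M]_X`, for
`X ⊆ T`. -/
def Qmap {X T : ObjectProperty C} (h : X ≤ T) : relK0 T →+ relK0 X :=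
  QuotientAddGroup.map _ _ (AddMonoidHom.id _) (relationSubgroup_antitone h)

@[simp]
theorem Qmap_index {X T : ObjectProperty C} (h : X ≤ T) (M : C) : Qmap h (index T M) = index X M := rfl

/-- The property defining the homomorphism `θ_D : K₀(mod D) → K₀(C, E_D, s_D)`:
`θ_D [H_D(M)] = [M]_D + [Σ⁻¹M]_D` for all `M` in `C`. -/
def IsTheta {D : ObjectProperty C} (hD : IsContravariantlyFinite D)
    (θ : K0 (FPMod D.FullSubcategory) →+ relK0 D) : Prop :=
  ∀ M : C, θ (K0.mk ((Hfun hD).obj M)) = index D M + index D (M⟦(-1 : ℤ)⟧)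

end Triangulated

end RelIndex

open RelIndex

/-! Write `doubleIndex` for the class [M] + [Σ⁻¹M]. By rigidity, a finitely presented functor with
presentation P → R is H_T(U) for the cone U of P → R, because R → U is then surjective on T.
Morphisms of functors out of such H_T(U) lift to C. A lifted isomorphism is bijective on T, and in
the index relations of its cone triangle the error terms cancel, so `doubleIndex` depends only on
the functor (`doubleIndex_eq_of_Hfun_iso`). A short exact sequence of functors need not come from a
triangle, but its middle term can be replaced by an object with the same H_T for which it does
(`doubleIndex_additive`). This gives θ_T; uniqueness follows since every functor is some H_T(U).

For the kernel, S_Y is H_T(U), where U is the cone of a right almost split E → Y. If Y is not in X,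
no map from X to Y is a split epimorphism, so H_X(U) = 0 and θ_T[S_Y] dies under Q
(`doubleIndex_cone_mem_ker`).

Conversely, a relation for X comes from δ : N → W with H_X(δ) = 0. Local boundedness gives Im H_T(δ)
finite total dimension, so if nonzero it contains a simple S_Y (`exists_socle`), and Y is not in X.
Realise S_Y ⊆ Im H_T(δ) by a map U → W and replace W by its cone W'. The octahedral axiom shows that
the relation changes by exactly `doubleIndex T U`, while the image shrinks. Once H_T(δ) = 0, the
class is zero in the group for T (`index_sub_add_mem`). -/

namespace RelIndex

universe v u w

/-! ### Vanishing, injectivity and surjectivity after restriction to a subcategory -/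

section Vanishing

variable {C : Type u} [Category.{v} C] [Preadditive C]

/-- `C(-, f)|_D` is zero. -/
def VanishesOn (D : ObjectProperty C) {M N : C} (f : M ⟶ N) : Prop :=
  ∀ ⦃t : C⦄, D t → ∀ x : t ⟶ M, x ≫ f = 0

/-- `C(-, f)|_D` is injective. -/
def InjectiveOn (D : ObjectProperty C) {M N : C} (f : M ⟶ N) : Prop :=
  ∀ ⦃t : C⦄, D t → ∀ x : t ⟶ M, x ≫ f = 0 → x = 0

/-- `C(-, f)|_D` is surjective. -/
def SurjectiveOn (D : ObjectProperty C) {M N : C} (f : M ⟶ N) : Prop :=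
  ∀ ⦃t : C⦄, D t → ∀ y : t ⟶ N, ∃ x : t ⟶ M, x ≫ f = y

theorem restrictedYoneda_map_eq_zero_iff {D : ObjectProperty C} {M N : C} (f : M ⟶ N) :
    (restrictedYoneda D).map f = 0 ↔ VanishesOn D f := by
  constructor
  · intro h t ht x
    exact congrArg (fun α => α x) (NatTrans.congr_app h (op ⟨t, ht⟩))
  · intro h
    ext t x
    exact h t.unop.property x

theorem VanishesOn.comp {M N P : C} {f : M ⟶ N} (hf : VanishesOn D f) (g : N ⟶ P) :
    VanishesOn D (f ≫ g) := fun _ ht x => by rw [← Category.assoc, hf ht x, zero_comp]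

end Vanishing

/-! ### Index relations from triangles -/

section Triangulated

variable {C : Type u} [Category.{v} C] [Preadditive C] [HasZeroObject C] [HasShift C ℤ]
  [∀ n : ℤ, (shiftFunctor C n).Additive] [Pretriangulated C]

theorem index_obj₂ {D : ObjectProperty C} (S : Triangle C) (hS : S ∈ distTriang C)
    (h : VanishesOn D S.mor₃) : index D S.obj₂ = index D S.obj₁ + index D S.obj₃ := by
  have : (QuotientAddGroup.mk
      (K0Split.mk S.obj₁ - K0Split.mk S.obj₂ + K0Split.mk S.obj₃) : relK0 D) = 0 :=
    (QuotientAddGroup.eq_zero_iff _).2 (AddSubgroup.subset_closure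
      ⟨_, _, _, S.mor₁, S.mor₂, S.mor₃, hS, (restrictedYoneda_map_eq_zero_iff _).2 h, rfl⟩)
  have h' : index D S.obj₁ - index D S.obj₂ + index D S.obj₃ = 0 := this
  rw [← sub_eq_zero, ← neg_eq_zero, ← h']
  abel

open ZeroObject in
theorem index_zero (D : ObjectProperty C) : index D (0 : C) = 0 := by
  have := index_obj₂ (D := D) _ (contractible_distinguished (0 : C)) fun t _ x => comp_zero
  simpa [contractibleTriangle] using this

open ZeroObject in
theorem index_of_iso (D : ObjectProperty C) {M N : C} (e : M ≅ N) : index D M = index D N := by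
  have := index_obj₂ (D := D) (Triangle.mk e.hom (0 : N ⟶ 0) 0)
    (isomorphic_distinguished _ (contractible_distinguished M) _
      (Triangle.isoMk _ _ (Iso.refl _) e.symm (Iso.refl _)
        (e.hom_inv_id.trans (Category.id_comp _).symm)
        (zero_comp.trans comp_zero.symm) (zero_comp.trans comp_zero.symm)))
    (fun t _ x => comp_zero)
  simpa [index_zero] using this.symm

variable {D : ObjectProperty C} {K L M : C} {f : K ⟶ L} {g : L ⟶ M} {δ : M ⟶ K⟦(1 : ℤ)⟧}

theorem index_mid (h : Triangle.mk f g δ ∈ distTriang C) (hδ : VanishesOn D δ) :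
    index D L = index D K + index D M :=
  index_obj₂ _ h hδ

theorem exists_lift_mor₁ (h : Triangle.mk f g δ ∈ distTriang C) {t : C} (x : t ⟶ L)
    (hx : x ≫ g = 0) : ∃ y : t ⟶ K, x = y ≫ f :=
  Triangle.coyoneda_exact₂ _ h x hx

theorem exists_lift_mor₂ (h : Triangle.mk f g δ ∈ distTriang C) {t : C} (x : t ⟶ M)
    (hx : x ≫ δ = 0) : ∃ y : t ⟶ L, x = y ≫ g :=
  Triangle.coyoneda_exact₃ _ h x hx

theorem exists_desc_mor₂ (h : Triangle.mk f g δ ∈ distTriang C) {t : C} (x : L ⟶ t)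
    (hx : f ≫ x = 0) : ∃ y : M ⟶ t, x = g ≫ y :=
  Triangle.yoneda_exact₂ _ h x hx

theorem vanishesOn_mor₃ (h : Triangle.mk f g δ ∈ distTriang C) (hg : SurjectiveOn D g) :
    VanishesOn D δ := by
  intro t ht x
  obtain ⟨y, rfl⟩ := hg ht x
  have : g ≫ δ = 0 := comp_distTriang_mor_zero₂₃ _ h
  rw [Category.assoc, this, comp_zero]

theorem vanishesOn_mor₂ (h : Triangle.mk f g δ ∈ distTriang C) (hf : SurjectiveOn D f) :
    VanishesOn D g := by
  intro t ht x
  obtain ⟨y, rfl⟩ := hf ht x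
  have : f ≫ g = 0 := comp_distTriang_mor_zero₁₂ _ h
  rw [Category.assoc, this, comp_zero]

theorem surjectiveOn_mor₂ (h : Triangle.mk f g δ ∈ distTriang C) (hδ : VanishesOn D δ) :
    SurjectiveOn D g := by
  intro t ht x
  obtain ⟨y, hy⟩ := exists_lift_mor₂ h x (hδ ht x)
  exact ⟨y, hy.symm⟩

theorem surjectiveOn_mor₁ (h : Triangle.mk f g δ ∈ distTriang C) (hg : VanishesOn D g) :
    SurjectiveOn D f := by
  intro t ht x
  obtain ⟨y, hy⟩ := exists_lift_mor₁ h x (hg ht x)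
  exact ⟨y, hy.symm⟩

/-- Inverse rotation makes `g`, up to a canonical isomorphism, the connecting morphism. The next two
lemmas rotate twice and three times. -/
theorem index_fst_of_vanishesOn (h : Triangle.mk f g δ ∈ distTriang C) (hg : VanishesOn D g) :
    index D K = index D (M⟦(-1 : ℤ)⟧) + index D L :=
  index_obj₂ _ (inv_rot_of_distTriang _ h) (hg.comp _)

theorem index_shift_trd_of_vanishesOn (h : Triangle.mk f g δ ∈ distTriang C)
    (hf : VanishesOn D f) :
    index D (M⟦(-1 : ℤ)⟧) = index D (L⟦(-1 : ℤ)⟧) + index D K :=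
  index_obj₂ _ (inv_rot_of_distTriang _ (inv_rot_of_distTriang _ h)) (hf.comp _)

theorem index_shift_mid_of_injectiveOn (h : Triangle.mk f g δ ∈ distTriang C)
    (hf : InjectiveOn D f) :
    index D (L⟦(-1 : ℤ)⟧) = index D (K⟦(-1 : ℤ)⟧) + index D (M⟦(-1 : ℤ)⟧) := by
  have h1 := inv_rot_of_distTriang _ h
  -- The connecting morphism is essentially Σ⁻¹M → K, which is killed by `f` and hence vanishes on
  -- `D` by injectivity.
  refine index_obj₂ _ (inv_rot_of_distTriang _ (inv_rot_of_distTriang _ h1))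
    (VanishesOn.comp (fun t ht x => hf ht _ ?_) _)
  have : _ ≫ f = 0 := comp_distTriang_mor_zero₁₂ _ h1
  exact (Category.assoc _ _ _).trans ((congrArg (x ≫ ·) this).trans comp_zero)

/-- `[M] + [Σ⁻¹M]` -/
noncomputable def doubleIndex (D : ObjectProperty C) (M : C) : relK0 D :=
  index D M + index D (M⟦(-1 : ℤ)⟧)

/-- With N the cone of `φ`, the class [Σ⁻¹N] enters [L] - [M] and [Σ⁻¹L] - [Σ⁻¹M] with opposite
signs. -/
theorem doubleIndex_eq_of_bijectiveOn {φ : L ⟶ M} (hi : InjectiveOn D φ)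
    (hs : SurjectiveOn D φ) : doubleIndex D L = doubleIndex D M := by
  obtain ⟨N, g, δ, h⟩ := distinguished_cocone_triangle φ
  have h1 := index_fst_of_vanishesOn h (vanishesOn_mor₂ h hs)
  have h2 := index_shift_mid_of_injectiveOn h hi
  rw [doubleIndex, doubleIndex, h1, h2]
  abel

theorem doubleIndex_mid (h : Triangle.mk f g δ ∈ distTriang C) (hf : InjectiveOn D f)
    (hg : SurjectiveOn D g) : doubleIndex D L = doubleIndex D K + doubleIndex D M := by
  rw [doubleIndex, doubleIndex, doubleIndex, index_mid h (vanishesOn_mor₃ h hg),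
    index_shift_mid_of_injectiveOn h hf]
  abel

/-- The octahedral axiom, with the second triangle rotated. -/
theorem octahedron_rotated [IsTriangulated C] {X Y Z W V : C} {a : X ⟶ Y} {p : Y ⟶ Z}
    {p' : Z ⟶ X⟦(1 : ℤ)⟧} {i : K ⟶ Y} {b : Y ⟶ W} {b' : W ⟶ K⟦(1 : ℤ)⟧} {c : X ⟶ W} {w : W ⟶ V}
    {w' : V ⟶ X⟦(1 : ℤ)⟧} (ha : Triangle.mk a p p' ∈ distTriang C)
    (hb : Triangle.mk i b b' ∈ distTriang C) (hc : Triangle.mk c w w' ∈ distTriang C)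
    (comm : a ≫ b = c) :
    ∃ (m : Z ⟶ V) (m' : V ⟶ K⟦(1 : ℤ)⟧), p ≫ m = b ≫ w ∧
      Triangle.mk (i ≫ p) m m' ∈ distTriang C := by
  have o := Triangulated.someOctahedron comm ha (rot_of_distTriang _ hb) hc
  refine ⟨o.m₁, o.m₃, o.comm₁, (Pretriangulated.rotate_distinguished_triangle _).2 ?_⟩
  have e : (-i⟦(1 : ℤ)⟧') ≫ p⟦(1 : ℤ)⟧' = -(i ≫ p)⟦(1 : ℤ)⟧' := by simp
  have key : ∀ z, (-i⟦(1 : ℤ)⟧') ≫ p⟦(1 : ℤ)⟧' = z → Triangle.mk o.m₁ o.m₃ z ∈ distTriang C := by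
    rintro _ rfl
    exact o.mem
  exact key _ e

/-- The connecting morphism lands in ΣK with K in `T`, so it vanishes on `T`. -/
theorem surjectiveOn_of_isRigid {T : ObjectProperty C} (hT : IsRigid T) (hK : T K)
    (h : Triangle.mk f g δ ∈ distTriang C) : SurjectiveOn T g :=
  surjectiveOn_mor₂ h fun _ ht x => hT ht hK (x ≫ δ)

/-- The maps A → B → N are exact only on `T`. Lift R₁ → R₀ → N to `r : R₁ ⟶ A` and `ρ : R₀ ⟶ B`, and
let E be the cone of R₁ → A ⊞ R₀. Then A → E → N is part of a triangle, and E → B is bijective on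
`T`. -/
theorem doubleIndex_additive [IsTriangulated C] {T : ObjectProperty C} (hT : IsRigid T)
    {R₁ R₀ A B N : C} (hR₁ : T R₁) (hR₀ : T R₀) {s : R₁ ⟶ R₀} {q : R₀ ⟶ N} {q' : N ⟶ R₁⟦(1 : ℤ)⟧}
    (hN : Triangle.mk s q q' ∈ distTriang C) {i : A ⟶ B} {p : B ⟶ N} (hi : InjectiveOn T i)
    (hp : SurjectiveOn T p)
    (hip : ∀ ⦃t : C⦄, T t → ∀ x : t ⟶ B, x ≫ p = 0 ↔ ∃ y, y ≫ i = x) :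
    doubleIndex T B = doubleIndex T A + doubleIndex T N := by
  have hq := surjectiveOn_of_isRigid hT hR₁ hN
  have hsq : s ≫ q = 0 := comp_distTriang_mor_zero₁₂ _ hN
  obtain ⟨ρ, hρ⟩ := hp hR₀ q
  obtain ⟨r, hr⟩ := (hip hR₁ (s ≫ ρ)).1 (by rw [Category.assoc, hρ, hsq])
  obtain ⟨E, d, d', hE⟩ := distinguished_cocone_triangle (biprod.lift r s)
  have hd := surjectiveOn_of_isRigid hT hR₁ hE
  -- The sign makes the composite with (r, s) vanish, since `r ≫ i = s ≫ ρ`.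
  obtain ⟨ψ, hψ⟩ := exists_desc_mor₂ hE (biprod.desc (-i) ρ) (by simp [hr])
  obtain ⟨m, m', hm, hdist⟩ := octahedron_rotated hE
    (binaryBiproductTriangle_distinguished A R₀) hN (by simp : _ = s)
  have hinl : (biprod.inl ≫ d) ≫ ψ = -i := by rw [Category.assoc, ← hψ]; simp
  have hinr : (biprod.inr ≫ d) ≫ ψ = ρ := by rw [Category.assoc, ← hψ]; simp
  have hip0 : ∀ ⦃t : C⦄, T t → ∀ x : t ⟶ A, x ≫ i ≫ p = 0 := fun t ht x => by
    rw [← Category.assoc]; exact (hip ht _).2 ⟨x, rfl⟩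
  have hψi : InjectiveOn T ψ := by
    intro t ht x hx
    obtain ⟨z, rfl⟩ := hd ht x
    obtain ⟨z₁, z₂, rfl⟩ : ∃ z₁ z₂, z = biprod.lift z₁ z₂ :=
      ⟨z ≫ biprod.fst, z ≫ biprod.snd, by ext <;> simp⟩
    rw [Category.assoc, ← hψ] at hx
    replace hx : -(z₁ ≫ i) + z₂ ≫ ρ = 0 := by simpa using hx
    have hx' : z₂ ≫ ρ = z₁ ≫ i := by rw [← sub_eq_zero, ← hx]; abel
    have hz₂ : z₂ ≫ q = 0 := by
      rw [← hρ, ← Category.assoc, hx', Category.assoc, hip0 ht]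
    obtain ⟨y, hy⟩ := exists_lift_mor₁ hN z₂ hz₂
    have hz₁ : z₁ = y ≫ r := by
      rw [← sub_eq_zero]
      apply hi ht
      rw [Preadditive.sub_comp, ← hx', hy, Category.assoc, Category.assoc, hr, sub_self]
    have : biprod.lift z₁ z₂ = y ≫ biprod.lift r s := by
      ext <;> simp [hz₁, hy]
    have h0 : biprod.lift r s ≫ d = 0 := comp_distTriang_mor_zero₁₂ _ hE
    rw [this, Category.assoc, h0, comp_zero]
  have hψs : SurjectiveOn T ψ := by
    intro t ht y
    obtain ⟨z, hz⟩ := hq ht (y ≫ p)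
    obtain ⟨x, hx⟩ := (hip ht (z ≫ ρ - y)).1 (by
      rw [Preadditive.sub_comp, Category.assoc, hρ, hz, sub_self])
    refine ⟨biprod.lift x z ≫ d, ?_⟩
    rw [Category.assoc, ← hψ, biprod.lift_desc, Preadditive.comp_neg, hx]
    abel
  rw [← doubleIndex_eq_of_bijectiveOn hψi hψs]
  refine doubleIndex_mid hdist ?_ ?_
  · intro t ht x hx
    apply hi ht
    have : x ≫ (biprod.inl ≫ d) ≫ ψ = 0 := by
      rw [← Category.assoc, show x ≫ biprod.inl ≫ d = 0 from hx, zero_comp]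
    rw [hinl] at this
    simpa using this
  · intro t ht y
    obtain ⟨z, rfl⟩ := hq ht y
    refine ⟨z ≫ biprod.inr ≫ d, ?_⟩
    have : d ≫ m = biprod.snd ≫ q := hm
    simp [this]

end Triangulated

/-! ### Quotients of functors and Grothendieck groups -/

section Generic

variable {A : Type u} [Category.{v} A]

theorem exists_desc_of_surjective {F G H : Aᵒᵖ ⥤ AddCommGrpCat.{v}} (p : F ⟶ G) (q : F ⟶ H)
    (hp : ∀ X, Function.Surjective (p.app X)) (h : ∀ X x, p.app X x = 0 → q.app X x = 0) :
    ∃ r : G ⟶ H, p ≫ r = q := by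
  let r (X : Aᵒᵖ) : G.obj X →+ H.obj X :=
    (p.app X).hom.liftOfSurjective (hp X) ⟨(q.app X).hom, fun x hx => h X x hx⟩
  have hr (X x) : r X (p.app X x) = q.app X x :=
    AddMonoidHom.liftOfRightInverse_comp_apply _ _ _ _ x
  refine ⟨{ app := fun X => AddCommGrpCat.ofHom (r X), naturality := fun X Y f => ?_ }, ?_⟩
  · ext y
    obtain ⟨x, rfl⟩ := hp X y
    change r Y (G.map f (p.app X x)) = H.map f (r X (p.app X x))
    rw [hr, ← NatTrans.naturality_apply, ← NatTrans.naturality_apply, hr]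
  · ext X x
    exact hr X x

theorem nonempty_iso_of_surjective {F G H : Aᵒᵖ ⥤ AddCommGrpCat.{v}} (p : F ⟶ G) (q : F ⟶ H)
    (hp : ∀ X, Function.Surjective (p.app X)) (hq : ∀ X, Function.Surjective (q.app X))
    (h : ∀ X x, p.app X x = 0 ↔ q.app X x = 0) : Nonempty (G ≅ H) := by
  obtain ⟨r, hr⟩ := exists_desc_of_surjective p q hp fun X x => (h X x).1
  obtain ⟨s, hs⟩ := exists_desc_of_surjective q p hq fun X x => (h X x).2
  have : Epi p := by
    have : ∀ X, Epi (p.app X) := fun X => (AddCommGrpCat.epi_iff_surjective _).2 (hp X)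
    exact NatTrans.epi_of_epi_app p
  have : Epi q := by
    have : ∀ X, Epi (q.app X) := fun X => (AddCommGrpCat.epi_iff_surjective _).2 (hq X)
    exact NatTrans.epi_of_epi_app q
  refine ⟨⟨r, s, ?_, ?_⟩⟩
  · rw [← cancel_epi p, ← Category.assoc, hr, hs, Category.comp_id]
  · rw [← cancel_epi q, ← Category.assoc, hs, hr, Category.comp_id]

theorem K0.mk_mid [HasZeroMorphisms A] (S : ShortComplex A) (hS : S.ShortExact) :
    K0.mk S.X₂ = K0.mk S.X₁ + K0.mk S.X₃ := by
  have : (QuotientAddGroup.mk (FreeAbelianGroup.of S.X₂ - FreeAbelianGroup.of S.X₁ -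
      FreeAbelianGroup.of S.X₃) : K0 A) = 0 :=
    (QuotientAddGroup.eq_zero_iff _).2 (AddSubgroup.subset_closure ⟨S, hS, rfl⟩)
  have h' : K0.mk S.X₂ - K0.mk S.X₁ - K0.mk S.X₃ = 0 := this
  rw [← sub_eq_zero, ← h']
  abel

theorem K0.mk_of_iso [Preadditive A] [HasZeroObject A] {M N : A} (e : M ≅ N) :
    K0.mk M = K0.mk N := by
  open ZeroObject in
  -- The sequence 0 → M → N is short exact; applied to the identity of 0, it gives [0] = 0.
  have key {M N : A} (e : M ≅ N) : K0.mk M = K0.mk (0 : A) + K0.mk N :=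
    K0.mk_mid (ShortComplex.mk (0 : (0 : A) ⟶ M) e.hom zero_comp)
      (ShortComplex.Splitting.ofIsZeroOfIsIso _ (isZero_zero A)
        (inferInstanceAs (IsIso e.hom))).shortExact
  rw [key e, left_eq_add.1 (key (Iso.refl (0 : A))), zero_add]

end Generic

/-! ### The radical of a representable functor -/

section Radical

variable {A : Type u} [Category.{v} A] [Preadditive A]

/-- The radical of `A(-, Y)` is the image of a right almost split morphism `E ⟶ Y`. -/
theorem mem_radical_iff {E Y : A} (f : E ⟶ Y) (hf : IsRightAlmostSplit f) {X : Aᵒᵖ}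
    (x : (preadditiveYoneda.obj Y).obj X) :
    x ∈ (radical (preadditiveYoneda.obj Y)).obj X ↔
      ∃ z : X.unop ⟶ E, z ≫ f = (show X.unop ⟶ Y from x) := by
  let im : AbSubfunctor (preadditiveYoneda.obj Y) :=
    { obj := fun X => ((preadditiveYoneda.map f).app X).hom.range
      map_mem := by
        rintro X Z g _ ⟨y, rfl⟩
        exact ⟨g.unop ≫ y, Category.assoc _ _ _⟩ }
  -- A split epimorphism generates all of A(-, Y), so a proper subfunctor contains none; hence `im`
  -- is the unique maximal subfunctor.
  have key : ∀ N : AbSubfunctor (preadditiveYoneda.obj Y), N ≠ ⊤ → N ≤ im := by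
    intro N hN X x hx
    by_cases hs : IsSplitEpi (show X.unop ⟶ Y from x)
    · refine absurd (le_antisymm le_top fun Z z _ => ?_) hN
      obtain ⟨s, hs⟩ := hs.exists_splitEpi.some
      have e : (preadditiveYoneda.obj Y).map (Quiver.Hom.op ((show Z.unop ⟶ Y from z) ≫ s)) x
          = z := by
        change ((show Z.unop ⟶ Y from z) ≫ s) ≫ (show X.unop ⟶ Y from x) = z
        rw [Category.assoc, hs, Category.comp_id]
      exact e ▸ N.map_mem _ x hx
    · exact hf.2 _ hs
  have him : im ≠ ⊤ := by
    intro h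
    have h1 : (show (preadditiveYoneda.obj Y).obj (op Y) from 𝟙 Y) ∈ im.obj (op Y) := by
      rw [h]
      exact AddSubgroup.mem_top _
    obtain ⟨s, hs⟩ := h1
    exact hf.1 ⟨⟨⟨s, hs⟩⟩⟩
  have hmax : IsCoatom im :=
    ⟨him, fun N hN => by_contra fun h => absurd (key N h) (not_le_of_gt hN)⟩
  have hrad : (radical (preadditiveYoneda.obj Y)).obj X = im.obj X := by
    apply le_antisymm
    · exact iInf_le (fun N : {N : AbSubfunctor (preadditiveYoneda.obj Y) // IsCoatom N} =>
        N.1.obj X) ⟨im, hmax⟩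
    · refine le_iInf fun N => ?_
      have : N.1 = im := by_contra fun hne =>
        him (N.2.2 im (lt_of_le_of_ne (key N.1 N.2.1) hne))
      rw [this]
  rw [hrad]
  rfl

end Radical

/-! ### Finitely presented functors as images of cones -/

section Triangulated

variable {C : Type u} [Category.{v} C] [Preadditive C] [HasZeroObject C] [HasShift C ℤ]
  [∀ n : ℤ, (shiftFunctor C n).Additive] [Pretriangulated C] {T : ObjectProperty C}

/-- Both functors are quotients of T(-, R) by the image of T(-, P): for U this combines rigidity
with exactness of the triangle. -/
theorem nonempty_iso_restrictedYoneda (hT : IsRigid T) {P R : T.FullSubcategory} (f : P ⟶ R)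
    {U : C} {π : R.obj ⟶ U} {δ : U ⟶ P.obj⟦(1 : ℤ)⟧} (h : Triangle.mk f.hom π δ ∈ distTriang C)
    {M : T.FullSubcategoryᵒᵖ ⥤ AddCommGrpCat.{v}} (p : preadditiveYoneda.obj R ⟶ M)
    (hp : ∀ X, Function.Surjective (p.app X))
    (hfp : ∀ (X : T.FullSubcategory) (x : X ⟶ R),
      p.app (op X) x = 0 ↔ ∃ z : X ⟶ P, z ≫ f = x) :
    Nonempty ((restrictedYoneda T).obj U ≅ M) := by
  let q : preadditiveYoneda.obj R ⟶ (restrictedYoneda T).obj U :=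
    { app := fun X => AddCommGrpCat.ofHom
        { toFun := fun g : X.unop ⟶ R => (show X.unop.obj ⟶ U from g.hom ≫ π)
          map_zero' := zero_comp
          map_add' := fun _ _ => Preadditive.add_comp _ _ _ _ _ _ }
      naturality := fun X Z f => by
        ext g
        exact Category.assoc _ _ _ }
  refine nonempty_iso_of_surjective q p (fun X y => ?_) hp (fun X x => ?_)
  · obtain ⟨x, hx⟩ := surjectiveOn_of_isRigid hT P.property h X.unop.property y
    exact ⟨T.homMk x, hx⟩
  · refine Iff.trans ?_ (hfp X.unop x).symm
    change X.unop ⟶ R at x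
    change x.hom ≫ π = 0 ↔ _
    constructor
    · intro hx
      obtain ⟨y, hy⟩ := exists_lift_mor₁ h x.hom hx
      exact ⟨T.homMk y, ObjectProperty.hom_ext _ hy.symm⟩
    · rintro ⟨z, rfl⟩
      have : f.hom ≫ π = 0 := comp_distTriang_mor_zero₁₂ _ h
      change (z.hom ≫ f.hom) ≫ π = 0
      rw [Category.assoc, this, comp_zero]

/-- `M` is isomorphic to `H_T(U)` for the cone `U` of a morphism of `T`. -/
theorem exists_iso_Hfun (hT : IsRigid T) (hTcf : IsContravariantlyFinite T)
    (M : FPMod T.FullSubcategory) :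
    ∃ (P R U : C) (f : P ⟶ R) (π : R ⟶ U) (δ : U ⟶ P⟦(1 : ℤ)⟧), T P ∧ T R ∧
      Triangle.mk f π δ ∈ distTriang C ∧ Nonempty ((Hfun hTcf).obj U ≅ M) := by
  obtain ⟨P, R, f, p, hfp⟩ := M.property
  obtain ⟨f, rfl⟩ : ∃ f' : P ⟶ R, preadditiveYoneda.map f' = f :=
    ⟨preadditiveYoneda.preimage f, preadditiveYoneda.map_preimage f⟩
  obtain ⟨U, π, δ, h⟩ := distinguished_cocone_triangle f.hom
  obtain ⟨e⟩ := nonempty_iso_restrictedYoneda hT f h p (fun X => (hfp X).2)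
    (fun X x => (hfp (op X)).1 x)
  exact ⟨P.obj, R.obj, U, f.hom, π, δ, P.property, R.property, h,
    ⟨(finitelyPresented T.FullSubcategory).isoMk e⟩⟩

theorem nonempty_Hfun_iso_simpleTop (hT : IsRigid T) (hTcf : IsContravariantlyFinite T)
    (hTras : HasRightAlmostSplitMorphisms T) {E Y : T.FullSubcategory} (hY : Indecomposable Y.obj)
    {f : E ⟶ Y} (hf : IsRightAlmostSplit f) {U : C} {π : Y.obj ⟶ U} {δ : U ⟶ E.obj⟦(1 : ℤ)⟧}
    (h : Triangle.mk f.hom π δ ∈ distTriang C) :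
    Nonempty ((Hfun hTcf).obj U ≅ simpleTop hTras Y hY) := by
  obtain ⟨e⟩ := nonempty_iso_restrictedYoneda hT f h (radical (preadditiveYoneda.obj Y)).proj
    (fun X => QuotientAddGroup.mk'_surjective _)
    (fun X x => (QuotientAddGroup.eq_zero_iff
      (N := (radical (preadditiveYoneda.obj Y)).obj (op X)) x).trans (mem_radical_iff f hf x))
  exact ⟨(finitelyPresented T.FullSubcategory).isoMk e⟩

theorem Hfun_map_eq_zero_iff (hTcf : IsContravariantlyFinite T) {M N : C} (f : M ⟶ N) :
    (Hfun hTcf).map f = 0 ↔ VanishesOn T f := by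
  rw [← restrictedYoneda_map_eq_zero_iff]
  exact ⟨fun h => congrArg (fun g => g.hom) h, fun h => ObjectProperty.hom_ext _ h⟩

theorem eq_of_Hfun_map_eq (hTcf : IsContravariantlyFinite T) {M N : C} (hM : T M) {f g : M ⟶ N}
    (h : (Hfun hTcf).map f = (Hfun hTcf).map g) : f = g := by
  have := congrArg (fun α => α.hom.app (op ⟨M, hM⟩) (𝟙 M)) h
  change 𝟙 M ≫ f = 𝟙 M ≫ g at this
  simpa using this

theorem Hfun_hom_app_comp (hTcf : IsContravariantlyFinite T) {U V : C}
    (α : (Hfun hTcf).obj U ⟶ (Hfun hTcf).obj V) {t t' : C} (ht : T t) (ht' : T t') (x : t ⟶ U)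
    (y : t' ⟶ t) : (show t' ⟶ V from α.hom.app (op ⟨t', ht'⟩) (y ≫ x)) =
      y ≫ (show t ⟶ V from α.hom.app (op ⟨t, ht⟩) x) :=
  NatTrans.naturality_apply α.hom
    (Quiver.Hom.op (T.homMk y : (⟨t', ht'⟩ : T.FullSubcategory) ⟶ ⟨t, ht⟩)) x

theorem Hfun_map_eq_of_surjectiveOn (hTcf : IsContravariantlyFinite T) {R U V : C}
    (α : (Hfun hTcf).obj U ⟶ (Hfun hTcf).obj V) (hR : T R) {π : R ⟶ U} (hπ : SurjectiveOn T π)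
    (φ : U ⟶ V) (hφ : π ≫ φ = α.hom.app (op ⟨R, hR⟩) π) : (Hfun hTcf).map φ = α := by
  refine ObjectProperty.hom_ext _ ?_
  ext t x
  change t.unop.obj ⟶ U at x
  obtain ⟨y, rfl⟩ := hπ t.unop.property x
  change (y ≫ π) ≫ φ = _
  rw [Category.assoc, hφ]
  exact (Hfun_hom_app_comp hTcf α hR t.unop.property π y).symm

theorem exists_Hfun_map_eq_of_mem (hTcf : IsContravariantlyFinite T) {t V : C} (ht : T t)
    (α : (Hfun hTcf).obj t ⟶ (Hfun hTcf).obj V) : ∃ φ : t ⟶ V, (Hfun hTcf).map φ = α :=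
  ⟨α.hom.app (op ⟨t, ht⟩) (𝟙 t), Hfun_map_eq_of_surjectiveOn hTcf α ht
    (fun _ _ y => ⟨y, Category.comp_id y⟩) _ (Category.id_comp _)⟩

/-- By Yoneda the composite with H_T(π) is a morphism R → V. It kills P, so it descends to the cone
U. -/
theorem exists_Hfun_map_eq (hT : IsRigid T) (hTcf : IsContravariantlyFinite T) {P R U V : C}
    (hP : T P) (hR : T R) {f : P ⟶ R} {π : R ⟶ U} {δ : U ⟶ P⟦(1 : ℤ)⟧}
    (h : Triangle.mk f π δ ∈ distTriang C) (α : (Hfun hTcf).obj U ⟶ (Hfun hTcf).obj V) :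
    ∃ φ : U ⟶ V, (Hfun hTcf).map φ = α := by
  let ρ : R ⟶ V := α.hom.app (op ⟨R, hR⟩) π
  have h0 : f ≫ ρ = 0 := by
    rw [← Hfun_hom_app_comp hTcf α hR hP π f,
      show f ≫ π = 0 from comp_distTriang_mor_zero₁₂ _ h]
    exact map_zero (α.hom.app (op ⟨P, hP⟩)).hom
  obtain ⟨φ, hφ⟩ := exists_desc_mor₂ h ρ h0
  exact ⟨φ, Hfun_map_eq_of_surjectiveOn hTcf α hR (surjectiveOn_of_isRigid hT hP h) φ hφ.symm⟩

end Triangulated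

/-! ### Exactness of functors and the homomorphism θ -/

section Triangulated

variable {C : Type u} [Category.{v} C] [Preadditive C] [HasZeroObject C] [HasShift C ℤ]
  [∀ n : ℤ, (shiftFunctor C n).Additive] [Pretriangulated C] {T : ObjectProperty C}

theorem hasZeroObject_FPMod (hTcf : IsContravariantlyFinite T) :
    HasZeroObject (FPMod T.FullSubcategory) := by
  open ZeroObject in
  refine ⟨(Hfun hTcf).obj (0 : C), ?_⟩
  rw [IsZero.iff_id_eq_zero]
  exact ((Hfun hTcf).map_id _).symm.trans
    ((Hfun_map_eq_zero_iff hTcf _).2 fun t _ x => (isZero_zero C).eq_of_tgt _ _)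

theorem injectiveOn_of_mono (hTcf : IsContravariantlyFinite T) {M N : C} (f : M ⟶ N)
    [Mono ((Hfun hTcf).map f)] : InjectiveOn T f := by
  intro t ht x hx
  refine eq_of_Hfun_map_eq hTcf ht ?_
  rw [← cancel_mono ((Hfun hTcf).map f), ← Functor.map_comp, ← Functor.map_comp, hx, zero_comp]

theorem surjectiveOn_of_epi (hTcf : IsContravariantlyFinite T) {M N : C} (f : M ⟶ N)
    [Epi ((Hfun hTcf).map f)] : SurjectiveOn T f := by
  obtain ⟨U, g, δ, h⟩ := distinguished_cocone_triangle f
  refine surjectiveOn_mor₁ h ((Hfun_map_eq_zero_iff hTcf g).1 ?_)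
  have hfg : f ≫ g = 0 := comp_distTriang_mor_zero₁₂ _ h
  rw [← cancel_epi ((Hfun hTcf).map f), ← Functor.map_comp, hfg, comp_zero,
    Hfun_map_eq_zero_iff]
  exact fun t _ x => comp_zero

/-- This is projectivity of H_T(t). It turns categorical epimorphisms and exactness into statements
about elements. -/
theorem surjective_of_epi (hT : IsRigid T) (hTcf : IsContravariantlyFinite T)
    {M N : FPMod T.FullSubcategory} (α : M ⟶ N) [Epi α] {t : C} (ht : T t)
    (x : (Hfun hTcf).obj t ⟶ N) : ∃ y : (Hfun hTcf).obj t ⟶ M, y ≫ α = x := by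
  obtain ⟨P, R, U, f, π, δ, hP, hR, h, ⟨e⟩⟩ := exists_iso_Hfun hT hTcf M
  obtain ⟨_, _, V, _, _, _, _, _, _, ⟨e'⟩⟩ := exists_iso_Hfun hT hTcf N
  obtain ⟨φ, hφ⟩ := exists_Hfun_map_eq hT hTcf hP hR h (e.hom ≫ α ≫ e'.inv)
  have : Epi ((Hfun hTcf).map φ) := by rw [hφ]; infer_instance
  have hφs := surjectiveOn_of_epi hTcf φ
  obtain ⟨ξ, hξ⟩ : ∃ ξ : t ⟶ V, (Hfun hTcf).map ξ = x ≫ e'.inv :=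
    exists_Hfun_map_eq_of_mem hTcf ht _
  obtain ⟨y, hy⟩ := hφs ht ξ
  refine ⟨(Hfun hTcf).map y ≫ e.hom, ?_⟩
  rw [← cancel_mono e'.inv, Category.assoc, Category.assoc, ← hφ, ← hξ, ← hy, Functor.map_comp]

theorem doubleIndex_eq_of_Hfun_iso (hT : IsRigid T) (hTcf : IsContravariantlyFinite T)
    {M N : C} (e : (Hfun hTcf).obj M ≅ (Hfun hTcf).obj N) :
    doubleIndex T M = doubleIndex T N := by
  -- Morphisms out of H_T(M) need not lift for arbitrary M, so M and N are both compared with a cone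
  -- U.
  obtain ⟨P, R, U, f, π, δ, hP, hR, h, ⟨e'⟩⟩ := exists_iso_Hfun hT hTcf ((Hfun hTcf).obj M)
  have key {V : C} (i : (Hfun hTcf).obj U ≅ (Hfun hTcf).obj V) :
      doubleIndex T U = doubleIndex T V := by
    obtain ⟨φ, hφ⟩ := exists_Hfun_map_eq hT hTcf hP hR h i.hom
    have : IsIso ((Hfun hTcf).map φ) := by rw [hφ]; infer_instance
    exact doubleIndex_eq_of_bijectiveOn (injectiveOn_of_mono hTcf φ) (surjectiveOn_of_epi hTcf φ)
  rw [← key e', key (e' ≪≫ e)]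

theorem doubleIndex_of_shortExact [IsTriangulated C] (hT : IsRigid T)
    (hTcf : IsContravariantlyFinite T) (S : ShortComplex (FPMod T.FullSubcategory))
    (hS : S.ShortExact) {M₁ M₂ M₃ : C} (i₁ : (Hfun hTcf).obj M₁ ≅ S.X₁)
    (i₂ : (Hfun hTcf).obj M₂ ≅ S.X₂) (i₃ : (Hfun hTcf).obj M₃ ≅ S.X₃) :
    doubleIndex T M₂ = doubleIndex T M₁ + doubleIndex T M₃ := by
  obtain ⟨_, _, U₁, _, _, _, hP₁, hR₁, h₁, ⟨e₁⟩⟩ := exists_iso_Hfun hT hTcf S.X₁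
  obtain ⟨_, _, U₂, _, _, _, hP₂, hR₂, h₂, ⟨e₂⟩⟩ := exists_iso_Hfun hT hTcf S.X₂
  obtain ⟨_, _, U₃, _, _, _, hP₃, hR₃, h₃, ⟨e₃⟩⟩ := exists_iso_Hfun hT hTcf S.X₃
  rw [doubleIndex_eq_of_Hfun_iso hT hTcf (i₁ ≪≫ e₁.symm),
    doubleIndex_eq_of_Hfun_iso hT hTcf (i₂ ≪≫ e₂.symm),
    doubleIndex_eq_of_Hfun_iso hT hTcf (i₃ ≪≫ e₃.symm)]
  obtain ⟨i, hi⟩ := exists_Hfun_map_eq hT hTcf hP₁ hR₁ h₁ (e₁.hom ≫ S.f ≫ e₂.inv)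
  obtain ⟨p, hp⟩ := exists_Hfun_map_eq hT hTcf hP₂ hR₂ h₂ (e₂.hom ≫ S.g ≫ e₃.inv)
  have := hS.mono_f
  have := hS.epi_g
  have : Mono ((Hfun hTcf).map i) := by rw [hi]; infer_instance
  have : Epi ((Hfun hTcf).map p) := by rw [hp]; infer_instance
  refine doubleIndex_additive hT hP₃ hR₃ h₃ (injectiveOn_of_mono hTcf i)
    (surjectiveOn_of_epi hTcf p) fun t ht x => ⟨fun hx => ?_, ?_⟩
  · obtain ⟨hd, hzero⟩ := hS.exact.condition
    have hepi : Epi hd.left.f' := hS.exact.epi_f' hd.left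
    have hx' : ((Hfun hTcf).map x ≫ e₂.hom) ≫ S.g = 0 := by
      rw [← cancel_mono e₃.inv, zero_comp, Category.assoc, Category.assoc, ← hp,
        ← Functor.map_comp, hx, Hfun_map_eq_zero_iff]
      exact fun t _ x => comp_zero
    -- Exactness makes S.X₁ → Ker S.g an epimorphism, so the lift of x to the kernel lifts further
    -- to S.X₁.
    obtain ⟨y, hy⟩ := surjective_of_epi hT hTcf hd.left.f' ht (hd.left.liftK _ hx')
    obtain ⟨z, hz⟩ := exists_Hfun_map_eq_of_mem hTcf ht (y ≫ e₁.inv)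
    refine ⟨z, eq_of_Hfun_map_eq hTcf ht ?_⟩
    rw [Functor.map_comp, hz, hi, ← cancel_mono e₂.hom]
    have := congrArg (· ≫ hd.left.i) hy
    simpa using this
  · rintro ⟨y, rfl⟩
    refine eq_of_Hfun_map_eq hTcf ht ?_
    rw [Functor.map_comp, Functor.map_comp, hi, hp, (Hfun_map_eq_zero_iff hTcf _).2
      fun t _ x => comp_zero]
    simp

/-- `θ_T`, with `θ_T [H_T(M)] = [M] + [Σ⁻¹M]`. -/
theorem exists_isTheta [IsTriangulated C] (hT : IsRigid T) (hTcf : IsContravariantlyFinite T) :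
    ∃ θ : K0 (FPMod T.FullSubcategory) →+ relK0 T, IsTheta hTcf θ := by
  have hU (M : FPMod T.FullSubcategory) : ∃ U, Nonempty ((Hfun hTcf).obj U ≅ M) := by
    obtain ⟨_, _, U, _, _, _, _, _, _, e⟩ := exists_iso_Hfun hT hTcf M
    exact ⟨U, e⟩
  choose U e using hU
  refine ⟨QuotientAddGroup.lift _ (FreeAbelianGroup.lift fun M => doubleIndex T (U M)) ?_,
    fun M => ?_⟩
  · rw [AddSubgroup.closure_le]
    rintro _ ⟨S, hS, rfl⟩
    change FreeAbelianGroup.lift (fun M => doubleIndex T (U M)) _ = 0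
    rw [map_sub, map_sub, FreeAbelianGroup.lift_apply_of, FreeAbelianGroup.lift_apply_of,
      FreeAbelianGroup.lift_apply_of, doubleIndex_of_shortExact hT hTcf S hS (e S.X₁).some
        (e S.X₂).some (e S.X₃).some]
    abel
  · change FreeAbelianGroup.lift (fun M => doubleIndex T (U M)) (FreeAbelianGroup.of _) = _
    rw [FreeAbelianGroup.lift_apply_of]
    exact doubleIndex_eq_of_Hfun_iso hT hTcf (e _).some

theorem IsTheta.apply_mk {hTcf : IsContravariantlyFinite T}
    {θ : K0 (FPMod T.FullSubcategory) →+ relK0 T} (hθ : IsTheta hTcf θ)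
    {M : FPMod T.FullSubcategory} {U : C} (e : (Hfun hTcf).obj U ≅ M) :
    θ (K0.mk M) = doubleIndex T U := by
  have := hasZeroObject_FPMod hTcf
  rw [← K0.mk_of_iso e]
  exact hθ U

theorem IsTheta.unique (hT : IsRigid T) {hTcf : IsContravariantlyFinite T}
    {θ θ' : K0 (FPMod T.FullSubcategory) →+ relK0 T} (hθ : IsTheta hTcf θ)
    (hθ' : IsTheta hTcf θ') : θ = θ' := by
  refine QuotientAddGroup.addMonoidHom_ext _ (FreeAbelianGroup.lift_ext _ _ fun M => ?_)
  obtain ⟨_, _, U, _, _, _, _, _, _, ⟨e⟩⟩ := exists_iso_Hfun hT hTcf M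
  exact (hθ.apply_mk e).trans (hθ'.apply_mk e).symm

end Triangulated

/-! ### Indecomposable summands, finiteness and socles -/

section Decomposition

variable {C : Type u} [Category.{v} C] [Preadditive C]

/-- The map a ↦ r ≫ a ≫ i embeds End A in End E. If it reached the identity, the idempotent `r ≫ i`
would be the identity. This supplies the induction measure for decomposing objects. -/
theorem finrank_end_lt (k : Type w) [Field k] [Linear k C] {A E : C} [Module.Finite k (E ⟶ E)]
    (i : A ⟶ E) (r : E ⟶ A) (hir : i ≫ r = 𝟙 A) (hri : r ≫ i ≠ 𝟙 E) :
    Module.finrank k (A ⟶ A) < Module.finrank k (E ⟶ E) := by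
  let φ : (A ⟶ A) →ₗ[k] (E ⟶ E) := Linear.leftComp k E r ∘ₗ Linear.rightComp k A i
  have hφ (a : A ⟶ A) : φ a = r ≫ a ≫ i := rfl
  have hinj : Function.Injective φ := by
    intro a b hab
    have key (c : A ⟶ A) : i ≫ φ c ≫ r = c := by
      rw [hφ, Category.assoc, Category.assoc, hir, Category.comp_id, ← Category.assoc, hir,
        Category.id_comp]
    rw [← key a, hab, key b]
  rw [← LinearMap.finrank_range_of_inj hinj]
  refine Submodule.finrank_lt fun h => hri ?_
  obtain ⟨a, ha⟩ : 𝟙 E ∈ LinearMap.range φ := h ▸ Submodule.mem_top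
  rw [hφ] at ha
  calc r ≫ i = (r ≫ i) ≫ r ≫ a ≫ i := by rw [ha, Category.comp_id]
    _ = r ≫ a ≫ i := by
      rw [Category.assoc, ← Category.assoc i, hir, Category.id_comp]
    _ = 𝟙 E := ha

/-- By rank-nullity it suffices that kernels grow, strictly at `s` because of `x`. -/
theorem sum_finrank_range_lt {k : Type w} [Field k] [Linear k C]
    (hHom : ∀ M N : C, Module.Finite k (M ⟶ N)) (F : Finset (Skeleton C)) {N W W' : C}
    (δ : N ⟶ W) (b : W ⟶ W') {s : Skeleton C} (hs : s ∈ F) (x : (fromSkeleton C).obj s ⟶ N)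
    (hx : x ≫ δ ≠ 0) (hx' : x ≫ δ ≫ b = 0) :
    ∑ t ∈ F, Module.finrank k
      (LinearMap.range (Linear.rightComp k ((fromSkeleton C).obj t) (δ ≫ b))) <
    ∑ t ∈ F, Module.finrank k
      (LinearMap.range (Linear.rightComp k ((fromSkeleton C).obj t) δ)) := by
  have hle (t : C) : LinearMap.ker (Linear.rightComp k t δ) ≤
      LinearMap.ker (Linear.rightComp k t (δ ≫ b)) := by
    intro y hy
    replace hy : y ≫ δ = 0 := hy
    change y ≫ δ ≫ b = 0
    rw [← Category.assoc, hy, zero_comp]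
  have hsum (t : C) := (Linear.rightComp k t δ).finrank_range_add_finrank_ker
  have hsum' (t : C) := (Linear.rightComp k t (δ ≫ b)).finrank_range_add_finrank_ker
  refine Finset.sum_lt_sum (fun t _ => ?_) ⟨s, hs, ?_⟩
  · have := Submodule.finrank_mono (hle ((fromSkeleton C).obj t))
    have := hsum ((fromSkeleton C).obj t)
    have := hsum' ((fromSkeleton C).obj t)
    omega
  · have := Submodule.finrank_lt_finrank_of_lt (lt_of_le_of_ne (hle ((fromSkeleton C).obj s))
      fun h => hx (show x ∈ LinearMap.ker (Linear.rightComp k _ δ) from h ▸ hx'))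
    have := hsum ((fromSkeleton C).obj s)
    have := hsum' ((fromSkeleton C).obj s)
    omega

variable [HasBinaryBiproducts C]

theorem IsAdditiveSubcategory.induction (k : Type w) [Field k] [Linear k C]
    (hHom : ∀ M : C, Module.Finite k (M ⟶ M)) {T : ObjectProperty C}
    (hT : IsAdditiveSubcategory T) {motive : C → Prop}
    (zero : ∀ M, IsZero M → motive M) (indec : ∀ M, T M → Indecomposable M → motive M)
    (sum : ∀ (M A B : C) (_ : M ≅ A ⊞ B), motive A → motive B → motive M) :
    ∀ M, T M → motive M := by
  intro M hM
  induction h : Module.finrank k (M ⟶ M) using Nat.strong_induction_on generalizing M with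
  | _ n ih =>
    subst h
    by_cases hz : IsZero M
    · exact zero M hz
    by_cases hi : Indecomposable M
    · exact indec M hM hi
    obtain ⟨A, B, e, hA, hB⟩ : ∃ (A B : C) (_ : M ≅ A ⊞ B), ¬ IsZero A ∧ ¬ IsZero B := by
      simpa [Indecomposable, hz] using hi
    have hAB := hT.of_iso e hM
    refine sum M A B e (ih _ (finrank_end_lt k (biprod.inl ≫ e.inv) (e.hom ≫ biprod.fst)
        (by simp) fun h => hB ?_) A (hT.summand_mem hAB) rfl)
      (ih _ (finrank_end_lt k (biprod.inr ≫ e.inv) (e.hom ≫ biprod.snd)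
        (by simp) fun h => hA ?_) B (hT.summand_mem (hT.of_iso (biprod.braiding A B) hAB)) rfl)
    · rw [IsZero.iff_id_eq_zero]
      have := congrArg (fun x => (biprod.inr ≫ e.inv) ≫ x ≫ (e.hom ≫ biprod.snd)) h
      simpa using this.symm
    · rw [IsZero.iff_id_eq_zero]
      have := congrArg (fun x => (biprod.inl ≫ e.inv) ≫ x ≫ (e.hom ≫ biprod.fst)) h
      simpa using this.symm

theorem exists_mem_indec_iso {T : ObjectProperty C} (hT : IsAdditiveSubcategory T) {M : C}
    (hM : T M) (hi : Indecomposable M) :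
    ∃ s ∈ indec T, Nonempty ((fromSkeleton C).obj s ≅ M) := by
  have e : (fromSkeleton C).obj (toSkeleton M) ≅ M := fromSkeletonToSkeletonIso M
  exact ⟨toSkeleton M, ⟨hT.of_iso e.symm hM, fun h => hi.1 (h.of_iso e.symm),
    fun A B f => hi.2 A B (e.symm ≪≫ f)⟩, ⟨e⟩⟩

theorem exists_indec_comp_ne_zero (k : Type w) [Field k] [Linear k C]
    (hHom : ∀ M : C, Module.Finite k (M ⟶ M)) {T : ObjectProperty C}
    (hT : IsAdditiveSubcategory T) {E : C} (hE : T E) {Z : C} (g : E ⟶ Z) (hg : g ≠ 0) :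
    ∃ s ∈ indec T, ∃ i : (fromSkeleton C).obj s ⟶ E, i ≫ g ≠ 0 := by
  refine hT.induction k hHom (motive := fun E => ∀ g : E ⟶ Z, g ≠ 0 →
    ∃ s ∈ indec T, ∃ i : (fromSkeleton C).obj s ⟶ E, i ≫ g ≠ 0) ?_ ?_ ?_ E hE g hg
  · exact fun M hM g hg => absurd (hM.eq_of_src _ _) hg
  · intro M hM hi g hg
    obtain ⟨s, hs, ⟨e⟩⟩ := exists_mem_indec_iso hT hM hi
    exact ⟨s, hs, e.hom, fun h => hg (by rw [← cancel_epi e.hom, h, comp_zero])⟩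
  · intro M A B e hA hB g hg
    by_cases h : (biprod.inl ≫ e.inv) ≫ g = 0
    · have h' : (biprod.inr ≫ e.inv) ≫ g ≠ 0 := fun h' => hg (by
        rw [← cancel_epi e.inv]
        ext
        · simpa using h
        · simpa using h')
      obtain ⟨s, hs, i, hi⟩ := hB _ h'
      exact ⟨s, hs, i ≫ biprod.inr ≫ e.inv, by rwa [Category.assoc]⟩
    · obtain ⟨s, hs, i, hi⟩ := hA _ h
      exact ⟨s, hs, i ≫ biprod.inl ≫ e.inv, by rwa [Category.assoc]⟩

theorem IsLocallyBounded.finite_of_mem {k : Type w} [Field k] [Linear k C]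
    (hHom : ∀ M : C, Module.Finite k (M ⟶ M)) {T : ObjectProperty C}
    (hT : IsAdditiveSubcategory T) (hTlb : IsLocallyBounded k T) {E : C} (hE : T E) :
    {s : Skeleton C | s ∈ indec T ∧ ∃ f : (fromSkeleton C).obj s ⟶ E, f ≠ 0}.Finite := by
  refine hT.induction k hHom (motive := fun E =>
    {s : Skeleton C | s ∈ indec T ∧ ∃ f : (fromSkeleton C).obj s ⟶ E, f ≠ 0}.Finite) ?_ ?_ ?_ E hE
  · intro M hM
    convert Set.finite_empty
    exact Set.eq_empty_of_forall_notMem fun s ⟨_, f, hf⟩ => hf (hM.eq_of_tgt _ _)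
  · intro M hM hi
    exact (hTlb.finite M hM hi).subset fun s hs => ⟨hs.1, Or.inr hs.2⟩
  · intro M A B e hA hB
    refine (hA.union hB).subset ?_
    rintro s ⟨hs, f, hf⟩
    by_cases h : f ≫ e.hom ≫ biprod.fst = 0
    · refine Or.inr ⟨hs, f ≫ e.hom ≫ biprod.snd, fun h' => hf ?_⟩
      rw [← cancel_mono e.hom]
      ext
      · simpa using h
      · simpa using h'
    · exact Or.inl ⟨hs, _, h⟩

/-- A nonzero image `Im C(-, δ)|_T` of finite length contains a simple subfunctor. -/
theorem exists_socle {k : Type w} [Field k] [Linear k C]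
    (hHom : ∀ M N : C, Module.Finite k (M ⟶ N)) {T : ObjectProperty C}
    (hT : IsAdditiveSubcategory T) {N W : C} (δ : N ⟶ W) (hδ : ¬ VanishesOn T δ)
    (F : Finset (Skeleton C))
    (hF : ∀ s ∈ indec T, ∀ x : (fromSkeleton C).obj s ⟶ N, x ≫ δ ≠ 0 → s ∈ F) :
    ∃ s, ∃ hs : s ∈ indec T, ∃ x : (fromSkeleton C).obj s ⟶ N, x ≫ δ ≠ 0 ∧
      ∀ (E : T.FullSubcategory) (f : E ⟶ ⟨(fromSkeleton C).obj s, hs.1⟩),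
        IsRightAlmostSplit f → f.hom ≫ x ≫ δ = 0 := by
  classical
  -- The sum of `d y` over F measures the subfunctor of C(-, W) generated by y; a generator `x ≫ δ`
  -- of minimal size is chosen.
  let d {M : C} (y : M ⟶ W) (t : Skeleton C) : ℕ :=
    Module.finrank k (LinearMap.range (Linear.rightComp k ((fromSkeleton C).obj t) y))
  have hne : ∃ n s, ∃ _ : s ∈ indec T, ∃ x : (fromSkeleton C).obj s ⟶ N, x ≫ δ ≠ 0 ∧
      ∑ t ∈ F, d (x ≫ δ) t = n := by
    simp only [VanishesOn, not_forall] at hδ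
    obtain ⟨t, ht, x, hx⟩ := hδ
    obtain ⟨s, hs, i, hi⟩ := exists_indec_comp_ne_zero k (fun M => hHom M M) hT ht _ hx
    exact ⟨_, s, hs, i ≫ x, by rwa [Category.assoc], rfl⟩
  obtain ⟨s, hs, x, hx, hn⟩ := Nat.find_spec hne
  refine ⟨s, hs, x, hx, fun E f hf => by_contra fun hfx => ?_⟩
  obtain ⟨t, ht, i, hi⟩ := exists_indec_comp_ne_zero k (fun M => hHom M M) hT E.property _ hfx
  have hle : ∀ r ∈ F, LinearMap.range (Linear.rightComp k ((fromSkeleton C).obj r)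
      ((i ≫ f.hom ≫ x) ≫ δ)) ≤
      LinearMap.range (Linear.rightComp k ((fromSkeleton C).obj r) (x ≫ δ)) := by
    rintro r - _ ⟨g, rfl⟩
    exact ⟨g ≫ i ≫ f.hom, by simp⟩
  have hsF := hF s hs x hx
  have hmin : ¬ ∑ r ∈ F, d ((i ≫ f.hom ≫ x) ≫ δ) r < ∑ r ∈ F, d (x ≫ δ) r := fun hlt =>
    Nat.find_min hne (hn ▸ hlt) ⟨t, ht, i ≫ f.hom ≫ x, by simpa using hi, rfl⟩
  -- Minimality forces equality at s itself, so the generator `x ≫ δ` lies in the smaller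
  -- subfunctor.
  have heq := Submodule.eq_of_le_of_finrank_le (hle s hsF) (not_lt.1 fun hlt => hmin
    (Finset.sum_lt_sum (fun r hr => Submodule.finrank_mono (hle r hr)) ⟨s, hsF, hlt⟩))
  obtain ⟨h, hh⟩ : x ≫ δ ∈ LinearMap.range (Linear.rightComp k ((fromSkeleton C).obj s)
      ((i ≫ f.hom ≫ x) ≫ δ)) := heq ▸ ⟨𝟙 _, by simp⟩
  replace hh : (h ≫ i ≫ f.hom) ≫ x ≫ δ = x ≫ δ := by simpa using hh
  let Y : T.FullSubcategory := ⟨(fromSkeleton C).obj s, hs.1⟩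
  -- A Nakayama argument: `c` kills `x ≫ δ`, so it is not a split epimorphism and factors through
  -- `f`; then so does the identity, a contradiction.
  let c : Y ⟶ Y := 𝟙 Y - T.homMk (h ≫ i) ≫ f
  have hc : c.hom ≫ x ≫ δ = 0 := by
    change (𝟙 _ - (h ≫ i) ≫ f.hom) ≫ x ≫ δ = 0
    rw [Preadditive.sub_comp, Category.assoc h i, hh, Category.id_comp, sub_self]
  by_cases hsplit : IsSplitEpi c
  · obtain ⟨σ, hσ⟩ := hsplit.exists_splitEpi.some
    have hσ' : σ.hom ≫ c.hom = 𝟙 _ := congrArg (fun a => a.hom) hσ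
    apply hx
    rw [← Category.id_comp (x ≫ δ), ← hσ', Category.assoc, hc, comp_zero]
  · obtain ⟨h', hh'⟩ := hf.2 c hsplit
    refine hf.1 ⟨⟨⟨h' + T.homMk (h ≫ i), ?_⟩⟩⟩
    rw [Preadditive.add_comp, hh', sub_add_cancel]

end Decomposition

/-! ### The kernel of Q -/

section Triangulated

variable {C : Type u} [Category.{v} C] [Preadditive C] [HasZeroObject C] [HasShift C ℤ]
  [∀ n : ℤ, (shiftFunctor C n).Additive] [Pretriangulated C] {X T : ObjectProperty C}

/-- `P ⟶ U`, a morphism to the cone of a right almost split `E ⟶ P`, is zero on objects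
mapping to `P` by morphisms that are not split epimorphisms. -/
theorem comp_cone_eq_zero {E P : T.FullSubcategory} {f : E ⟶ P} (hf : IsRightAlmostSplit f) {U : C}
    {π : P.obj ⟶ U} {δ : U ⟶ E.obj⟦(1 : ℤ)⟧} (h : Triangle.mk f.hom π δ ∈ distTriang C)
    {Z : T.FullSubcategory} (z : Z ⟶ P) (hz : ¬ IsSplitEpi z) : z.hom ≫ π = 0 := by
  obtain ⟨y, rfl⟩ := hf.2 z hz
  have h0 : f.hom ≫ π = 0 := comp_distTriang_mor_zero₁₂ _ h
  change (y.hom ≫ f.hom) ≫ π = 0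
  rw [Category.assoc, h0, comp_zero]

/-- The morphism from the cone `U` of a right almost split `E ⟶ P` induced by `y : P ⟶ W` is
injective on `T` if `y ≠ 0`. -/
theorem injectiveOn_of_cone (hT : IsRigid T) {E P : T.FullSubcategory} {f : E ⟶ P}
    (hf : IsRightAlmostSplit f) {U W : C} {π : P.obj ⟶ U} {δ : U ⟶ E.obj⟦(1 : ℤ)⟧}
    (h : Triangle.mk f.hom π δ ∈ distTriang C) (g : U ⟶ W) (hg : π ≫ g ≠ 0) :
    InjectiveOn T g := by
  intro t ht z hz
  obtain ⟨z, rfl⟩ := surjectiveOn_of_isRigid hT E.property h ht z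
  refine comp_cone_eq_zero hf h (T.homMk z : (⟨t, ht⟩ : T.FullSubcategory) ⟶ P) fun hs => hg ?_
  obtain ⟨σ, hσ⟩ := hs.exists_splitEpi.some
  have hσ' : σ.hom ≫ z = 𝟙 _ := congrArg (fun a => a.hom) hσ
  rw [← Category.id_comp (π ≫ g), ← hσ', Category.assoc, ← Category.assoc z, hz, comp_zero]

theorem IsAdditiveSubcategory.mem_of_retract (hX : IsAdditiveSubcategory X) {M N : C} (hN : X N)
    (i : M ⟶ N) (r : N ⟶ M) (h : i ≫ r = 𝟙 M) : X M := by
  -- The cone of a split monomorphism is a complement of it.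
  obtain ⟨K, f, δ, hdist⟩ := distinguished_cocone_triangle i
  have hδ : δ = 0 := by
    have h31 : δ ≫ i⟦(1 : ℤ)⟧' = 0 := comp_distTriang_mor_zero₃₁ _ hdist
    have := congrArg (· ≫ r⟦(1 : ℤ)⟧') h31
    simpa [← Functor.map_comp, h] using this
  obtain ⟨e, -⟩ := exists_iso_binaryBiproduct_of_distTriang _ hdist hδ
  exact hX.summand_mem (hX.of_iso e hN)

/-- The identity of U vanishes on `X`, so a rotation of the triangle U → U → 0 is a relation. -/
theorem doubleIndex_eq_zero {U : C} (hU : VanishesOn X (𝟙 U)) :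
    doubleIndex X U = 0 := by
  open ZeroObject in
  have h := index_shift_trd_of_vanishesOn (contractible_distinguished U) hU
  have hz : IsZero ((0 : C)⟦(-1 : ℤ)⟧) := (shiftFunctor C (-1 : ℤ)).map_isZero (isZero_zero C)
  rw [index_of_iso X (hz.iso (isZero_zero C)), index_zero] at h
  rw [doubleIndex, add_comm]
  exact h.symm

/-- For a morphism `δ` with `C(-, δ)|_X = 0` completed to a triangle `N ⟶ W ⟶ V ⟶ ΣN`, the class
`[Σ⁻¹W] - [Σ⁻¹V] + [N]` is a sum of classes `[U] + [Σ⁻¹U]` for cones `U` of right almost split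
morphisms of `T` whose target does not lie in `X`. -/
theorem index_sub_add_mem [IsTriangulated C] {k : Type w} [Field k] [Linear k C]
    (hHom : ∀ M N : C, Module.Finite k (M ⟶ N)) (hT : IsAdditiveSubcategory T)
    (hTrigid : IsRigid T) (hTras : HasRightAlmostSplitMorphisms T) (G : AddSubgroup (relK0 T))
    (hG : ∀ (s : Skeleton C) (hs : s ∈ indec T), s ∉ indec X → ∀ (E : T.FullSubcategory)
      (f : E ⟶ ⟨(fromSkeleton C).obj s, hs.1⟩), IsRightAlmostSplit f → ∀ (U : C)
      (π : (fromSkeleton C).obj s ⟶ U) (δ : U ⟶ E.obj⟦(1 : ℤ)⟧),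
      Triangle.mk f.hom π δ ∈ distTriang C → doubleIndex T U ∈ G)
    {N : C} (F : Finset (Skeleton C))
    (hF : ∀ s ∈ indec T, ∀ x : (fromSkeleton C).obj s ⟶ N, x ≠ 0 → s ∈ F)
    (n : ℕ) : ∀ (W V : C) (δ : N ⟶ W) (w : W ⟶ V) (w' : V ⟶ N⟦(1 : ℤ)⟧), VanishesOn X δ →
      ∑ t ∈ F, Module.finrank k
        (LinearMap.range (Linear.rightComp k ((fromSkeleton C).obj t) δ)) = n →
      Triangle.mk δ w w' ∈ distTriang C →
      index T (W⟦(-1 : ℤ)⟧) - index T (V⟦(-1 : ℤ)⟧) + index T N ∈ G := by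
  induction n using Nat.strong_induction_on with
  | _ n ih =>
    intro W V δ w w' hδX hn hdist
    by_cases hδ : VanishesOn T δ
    · rw [index_shift_trd_of_vanishesOn hdist hδ]
      simp
    obtain ⟨s, hs, x, hx, hfx⟩ := exists_socle (k := k) hHom hT δ hδ F fun s hs x hx =>
      hF s hs x fun h => hx (by rw [h, zero_comp])
    obtain ⟨E, f, hf⟩ := hTras ⟨(fromSkeleton C).obj s, hs.1⟩ hs.2
    obtain ⟨U, π, ε, hU⟩ := distinguished_cocone_triangle f.hom
    -- H_T(g) embeds the simple H_T(U) in Im H_T(δ); composing with `b : W ⟶ W'` removes it from the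
    -- image.
    obtain ⟨g, hg⟩ := exists_desc_mor₂ hU (x ≫ δ) (hfx E f hf)
    obtain ⟨W', b, b', hW'⟩ := distinguished_cocone_triangle g
    obtain ⟨V', c, c', hV'⟩ := distinguished_cocone_triangle (δ ≫ b)
    obtain ⟨m, m', -, hm⟩ := octahedron_rotated hdist hW' hV' rfl
    have hgb : g ≫ b = 0 := comp_distTriang_mor_zero₁₂ _ hW'
    have hδw : δ ≫ w = 0 := comp_distTriang_mor_zero₁₂ _ hdist
    have hgi : InjectiveOn T g := injectiveOn_of_cone hTrigid hf hU g (hg ▸ hx)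
    have hgw : VanishesOn T (g ≫ w) := by
      intro t ht z
      obtain ⟨z, rfl⟩ := surjectiveOn_of_isRigid hTrigid E.property hU ht z
      rw [Category.assoc, ← Category.assoc π, ← hg, Category.assoc, hδw, comp_zero, comp_zero]
    have hsX : s ∉ indec X := fun h => hx (hδX h.1 x)
    have hlt := sum_finrank_range_lt (k := k) hHom F δ b
      (hF s hs x fun h => hx (by rw [h, zero_comp])) x hx
      (by rw [← Category.assoc, hg, Category.assoc, hgb, comp_zero])
    have h1 := ih _ (hn ▸ hlt) W' V' (δ ≫ b) c c' (hδX.comp b) rfl hV'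
    have h2 := hG s hs hsX E f hf U π ε hU
    rw [index_shift_mid_of_injectiveOn hW' hgi]
    -- It remains to use [Σ⁻¹V'] = [Σ⁻¹V] + [U], from the octahedral triangle U → V → V', whose
    -- first map vanishes on `T`.
    convert G.add_mem h1 h2 using 1
    rw [index_shift_trd_of_vanishesOn hm hgw, doubleIndex]
    abel

theorem ker_Qmap_le [IsTriangulated C] {k : Type w} [Field k] [Linear k C]
    (hHom : ∀ M N : C, Module.Finite k (M ⟶ N)) (hXT : X ≤ T) (hT : IsAdditiveSubcategory T)
    (hTcf : IsContravariantlyFinite T) (hTrigid : IsRigid T) (hTlb : IsLocallyBounded k T)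
    (hTras : HasRightAlmostSplitMorphisms T) (G : AddSubgroup (relK0 T))
    (hG : ∀ (s : Skeleton C) (hs : s ∈ indec T), s ∉ indec X → ∀ (E : T.FullSubcategory)
      (f : E ⟶ ⟨(fromSkeleton C).obj s, hs.1⟩), IsRightAlmostSplit f → ∀ (U : C)
      (π : (fromSkeleton C).obj s ⟶ U) (δ : U ⟶ E.obj⟦(1 : ℤ)⟧),
      Triangle.mk f.hom π δ ∈ distTriang C → doubleIndex T U ∈ G) :
    (Qmap hXT).ker ≤ G := by
  have key : relationSubgroup X ≤ G.comap (QuotientAddGroup.mk' (relationSubgroup T)) := by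
    rw [relationSubgroup, AddSubgroup.closure_le]
    rintro _ ⟨L, M, N, f, g, δ, hd, hδ, rfl⟩
    -- Every map from `T` to N factors through the approximation R, so local boundedness at R bounds
    -- the support of C(-, N) on `T`.
    obtain ⟨R, ξ, hR, hξ⟩ := hTcf N
    have hfin := hTlb.finite_of_mem (fun M => hHom M M) hT hR
    have hmem := index_sub_add_mem hHom hT hTrigid hTras G hG (N := N) hfin.toFinset
      (fun s hs x hx => hfin.mem_toFinset.2 ⟨hs, by
        obtain ⟨h, rfl⟩ := hξ hs.1 x
        exact ⟨h, fun h0 => hx (by rw [h0, zero_comp])⟩⟩) _ _ _ δ _ _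
      ((restrictedYoneda_map_eq_zero_iff δ).1 hδ) rfl
      (rot_of_distTriang _ (rot_of_distTriang _ hd))
    have hL := index_of_iso T (shiftShiftNeg L (1 : ℤ))
    have hM := index_of_iso T (shiftShiftNeg M (1 : ℤ))
    change index T (L⟦(1 : ℤ)⟧⟦(-1 : ℤ)⟧) - index T (M⟦(1 : ℤ)⟧⟦(-1 : ℤ)⟧) + index T N ∈ G at hmem
    rw [hL, hM] at hmem
    exact hmem
  intro z hz
  induction z using QuotientAddGroup.induction_on with
  | H a => exact key ((QuotientAddGroup.eq_zero_iff a).1 hz)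

/-- A map from an object of `X` to U lifts to P by rigidity. The lift is not a split epimorphism, as
`X` is closed under retracts, so it factors through `f` and dies in U. -/
theorem doubleIndex_cone_mem_ker (hXT : X ≤ T) (hX : IsAdditiveSubcategory X) (hTrigid : IsRigid T)
    {E P : T.FullSubcategory} (hP : ¬ X P.obj) {f : E ⟶ P} (hf : IsRightAlmostSplit f) {U : C}
    {π : P.obj ⟶ U} {δ : U ⟶ E.obj⟦(1 : ℤ)⟧} (h : Triangle.mk f.hom π δ ∈ distTriang C) :
    doubleIndex T U ∈ (Qmap hXT).ker := by
  refine (map_add _ _ _).trans (doubleIndex_eq_zero (X := X) fun t ht x => ?_)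
  obtain ⟨z, rfl⟩ := surjectiveOn_of_isRigid hTrigid E.property h (hXT _ ht) x
  rw [Category.comp_id]
  refine comp_cone_eq_zero hf h (T.homMk z : (⟨t, hXT _ ht⟩ : T.FullSubcategory) ⟶ P)
    fun hs => hP ?_
  obtain ⟨σ, hσ⟩ := hs.exists_splitEpi.some
  exact hX.mem_of_retract ht σ.hom z (congrArg (fun a => a.hom) hσ)

end Triangulated

end RelIndex

theorem mainTheorem4 {k : Type*} [Field k] {C : Type*} [Category* C] [Preadditive C] [Linear k C]
    [HasZeroObject C] [HasShift C ℤ] [∀ n : ℤ, (shiftFunctor C n).Additive] [Pretriangulated C]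
    [IsTriangulated C] [IsIdempotentComplete C]
    (hHom : ∀ M N : C, Module.Finite k (M ⟶ N))
    (X T Y : ObjectProperty C)
    (hX : IsAdditiveSubcategory X) (hT : IsAdditiveSubcategory T) (hY : IsAdditiveSubcategory Y)
    (hXT : X ≤ T)
    (hXcf : IsContravariantlyFinite X) (hTcf : IsContravariantlyFinite T)
    (hTrigid : IsRigid T)
    (hunion : indec T = indec X ∪ indec Y) (hdisj : Disjoint (indec X) (indec Y))
    (hTlb : IsLocallyBounded k T) (hTras : HasRightAlmostSplitMorphisms T) :
    (∃! θ : K0 (FPMod T.FullSubcategory) →+ relK0 T, IsTheta hTcf θ) ∧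
    ∀ θ : K0 (FPMod T.FullSubcategory) →+ relK0 T, IsTheta hTcf θ →
      (Qmap hXT).ker = AddSubgroup.closure (Set.range fun s : indec Y =>
        θ (K0.mk (simpleTop hTras
          ⟨(fromSkeleton C).obj s.1, (hunion.ge (Or.inr s.2)).1⟩ s.2.2))) := by
  obtain ⟨θ₀, hθ₀⟩ := exists_isTheta hTrigid hTcf
  refine ⟨⟨θ₀, hθ₀, fun θ hθ => hθ.unique hTrigid hθ₀⟩, fun θ hθ => le_antisymm ?_ ?_⟩
  · refine ker_Qmap_le hHom hXT hT hTcf hTrigid hTlb hTras _ fun s hs hsX E f hf U π δ h => ?_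
    have hsY : s ∈ indec Y := (hunion.le hs).resolve_left hsX
    obtain ⟨e⟩ := nonempty_Hfun_iso_simpleTop hTrigid hTcf hTras hs.2 hf h
    rw [← hθ.apply_mk e]
    exact AddSubgroup.subset_closure ⟨⟨s, hsY⟩, rfl⟩
  · rw [AddSubgroup.closure_le]
    rintro _ ⟨s, rfl⟩
    have hs : s.1 ∈ indec T := hunion.ge (Or.inr s.2)
    obtain ⟨E, f, hf⟩ := hTras ⟨(fromSkeleton C).obj s.1, hs.1⟩ hs.2
    obtain ⟨U, π, δ, h⟩ := distinguished_cocone_triangle f.hom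
    obtain ⟨e⟩ := nonempty_Hfun_iso_simpleTop hTrigid hTcf hTras hs.2 hf h
    have hmem := doubleIndex_cone_mem_ker hXT hX hTrigid
      (fun hsX => Set.disjoint_left.1 hdisj ⟨hsX, hs.2⟩ s.2) hf h
    rw [← hθ.apply_mk e] at hmem
    exact hmem
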